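/- All graphs are finite and simple; $\Delta(G)$ denotes the maximum degree of $G$ and $\chi'(G)$ its chromatic index, the least number of colors in an edge coloring of $G$ in which distinct edges sharing an endpoint receive distinct colors. A graph $G$ is *Class 2* if $\chi'(G)=\Delta(G)+1$. It is a *split graph* if its vertex set can be partitioned into a clique and an independent set (either of which may be empty). The *stretch index* $\sigma(G)$ of a connected graph $G$ is the least $t$ for which $G$ has a spanning tree $T$ such that any two vertices adjacent in $G$ are at distance at most $t$ in $T$. A graph $H$ on $n$ vertices is *overfull* if $|E(H)|>\Delta(H)\lfloor n/2\rfloor$. A graph $G$ is *neighborhood-overfull* if there is a vertex $v$ such that the subgraph $H$ of $G$ induced by $v$ and all its neighbors is overfull and $d_G(v)=\Delta(H)=\Delta(G)$. **Theorem.** Let $G$ be a connected split graph with $\sigma(G)=2$ and even maximum degree. Then $G$ is Class 2 if and only if $G$ is neighborhood-overfull. -/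

import Mathlib

/-- A split graph: the vertex set is partitioned into a clique `X` and an independent set `Y`. -/
def SimpleGraph.IsSplitGraph {V : Type*} (G : SimpleGraph V) : Prop :=
  ∃ X Y : Set V, X ∪ Y = Set.univ ∧ Disjoint X Y ∧ G.IsClique X ∧ G.IsIndepSet Y

/-- `T` is a tree `t`-spanner of `G`: a spanning tree of `G` (a tree on the same vertex set, all of
whose edges are edges of `G`) in which any two vertices adjacent in `G` are at distance at most
`t`. -/
def SimpleGraph.IsTreeSpanner {V : Type*} (G T : SimpleGraph V) (t : ℕ) : Prop :=
  T ≤ G ∧ T.IsTree ∧ ∀ u v : V, G.Adj u v → T.dist u v ≤ t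

/-- `G` is `t`-admissible if it has a tree `t`-spanner. -/
def SimpleGraph.IsAdmissible {V : Type*} (G : SimpleGraph V) (t : ℕ) : Prop :=
  ∃ T : SimpleGraph V, G.IsTreeSpanner T t

/-- The stretch index: the least `t` such that `G` is `t`-admissible (`⊤` if there is none, for
instance if `G` is disconnected). -/
noncomputable def SimpleGraph.stretchIndex {V : Type*} (G : SimpleGraph V) : ℕ∞ :=
  ⨅ (t : ℕ) (_ : G.IsAdmissible t), (t : ℕ∞)

/-- The chromatic index: the least number of colours in a colouring of the edges in which distinct
edges with a common endpoint receive distinct colours. -/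
noncomputable def SimpleGraph.chromaticIndex {V : Type*} (G : SimpleGraph V) : ℕ∞ :=
  G.lineGraph.chromaticNumber

/-- Class 2: the chromatic index is the maximum degree plus one. -/
def SimpleGraph.IsClassTwo {V : Type*} [Fintype V] (G : SimpleGraph V) [DecidableRel G.Adj] :
    Prop :=
  G.chromaticIndex = ((G.maxDegree + 1 : ℕ) : ℕ∞)

/-- Overfull: `|E(G)| > Δ(G) ⌊n / 2⌋`, where `n = |V(G)|`. -/
def SimpleGraph.IsOverfull {V : Type*} [Fintype V] (G : SimpleGraph V) [DecidableRel G.Adj] :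
    Prop :=
  G.maxDegree * (Fintype.card V / 2) < G.edgeSet.ncard

open Classical in
/-- Neighborhood-overfull: for some vertex `v`, the subgraph `H` of `G` induced by the closed
neighborhood of `v` is overfull, has `Δ(H) = Δ(G)`, and `d(v) = Δ(H)`. -/
def SimpleGraph.IsNeighborhoodOverfull {V : Type*} [Fintype V] (G : SimpleGraph V)
    [DecidableRel G.Adj] : Prop :=
  ∃ v : V,
    (G.induce (insert v (G.neighborSet v))).maxDegree = G.maxDegree ∧
    G.degree v = (G.induce (insert v (G.neighborSet v))).maxDegree ∧
    (G.induce (insert v (G.neighborSet v))).IsOverfull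

/-! A tree 2-spanner forces a center `c`: every vertex outside its closed neighborhood N[c] has at
most one neighbor (`IsSplitGraph.exists_center`). Such pendant edges can be colored greedily, so
only the graph on N[c] matters. If deg c < Δ, then N[c] has at most Δ vertices and addition modulo
|N[c]| colors its edges. If deg c = Δ = 2m, then N[c] has 2m + 1 vertices, and without overfullness
it misses at least m edges of the complete graph. As G is split, m missing edges can be chosen to
form a graph F on a set W of at most m + 1 vertices. It remains to color K_{2m+1} - F with 2m
colors. Each color class must then miss exactly one vertex. The darts of F serve as colors, each
reserved to be missing at its first endpoint. The edges inside W are colored greedily, and the other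
vertices are added one at a time by bipartite matchings, as in Cruse's embedding theorem
(`IsReservedColoringOn.exists_insert`). Conversely, Δ matchings cannot cover an overfull subgraph of
maximum degree Δ. -/

namespace SimpleGraph

/-! ### Tree 2-spanners of split graphs -/

/-- A tree has at most one edge at `z` leading towards `x`. -/
theorem IsTree.eq_of_dist_lt {V : Type*} {T : SimpleGraph V} (hT : T.IsTree) {x z p q : V}
    (hp : T.Adj z p) (hq : T.Adj z q) (hxp : T.dist x p < T.dist x z)
    (hxq : T.dist x q < T.dist x z) : p = q := by
  obtain ⟨r, hr, hlen⟩ := hT.connected.exists_path_of_dist x z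
  have key : ∀ w, T.Adj z w → T.dist x w < T.dist x z → w = r.penultimate := by
    intro w hw hlt
    refine hT.isAcyclic.eq_penultimate_of_adj_end hr hw ?_
    by_contra hmem
    obtain ⟨s, hs, hslen⟩ := hT.connected.exists_path_of_dist x w
    have := (hT.isAcyclic.subsingleton_path x w).elim ⟨s, hs⟩
      ⟨r.concat hw, hr.concat hmem hw⟩
    have h2 : s = r.concat hw := congrArg Subtype.val this
    rw [h2, Walk.length_concat] at hslen
    omega
  rw [key p hp hxp, key q hq hxq]

/-- Adjacent vertices of a tree differ by exactly 1 in distance from `x`. If `z` were at distance at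
least 2, both `p` and `q` would be closer to `x` than `z`, which only one neighbor can be. -/
theorem IsTree.dist_le_one_of_two_neighbors {V : Type*} {T : SimpleGraph V} (hT : T.IsTree)
    {x z p q : V} (hp : T.Adj z p) (hq : T.Adj z q) (hpq : p ≠ q) (hxp : T.dist x p ≤ 2)
    (hxq : T.dist x q ≤ 2) : T.dist x z ≤ 1 := by
  by_contra! h
  refine hpq (hT.eq_of_dist_lt hp hq (x := x) ?_ ?_)
  · rcases hT.dist_eq_dist_add_one_of_adj x hp with h | h <;> omega
  · rcases hT.dist_eq_dist_add_one_of_adj x hq with h | h <;> omega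

theorem IsTree.eq_or_adj_of_dist_le_one {V : Type*} {T : SimpleGraph V} (hT : T.IsTree)
    {x z : V} (h : T.dist x z ≤ 1) : x = z ∨ T.Adj x z := by
  rcases Nat.le_one_iff_eq_zero_or_eq_one.mp h with h | h
  · exact .inl (hT.connected.dist_eq_zero_iff.mp h)
  · exact .inr (dist_eq_one_iff_adj.mp h)

theorem IsTree.exists_adj_adj_of_dist_eq_two {V : Type*} {T : SimpleGraph V} (hT : T.IsTree)
    {x y : V} (h : T.dist x y = 2) : ∃ z, T.Adj z x ∧ T.Adj z y := by
  obtain ⟨p, hp⟩ := hT.connected.exists_walk_length_eq_dist x y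
  rw [h] at hp
  match p, hp with
  | .cons h1 (.cons h2 .nil), _ => exact ⟨_, h1.symm, h2⟩

/-- A split graph with a tree 2-spanner consists of a closed neighborhood together with pendant
vertices. -/
theorem IsSplitGraph.exists_center {V : Type*} {G T : SimpleGraph V} (hG : G.IsSplitGraph)
    (hT : G.IsTreeSpanner T 2) :
    ∃ c, ∀ v, v ≠ c → ¬ G.Adj c v → ∀ x y, G.Adj v x → G.Adj v y → x = y := by
  obtain ⟨X, Y, hXY, -, hX, hY⟩ := hG
  obtain ⟨hTG, hT, hd⟩ := hT
  have hmem : ∀ v, v ∉ X → v ∈ Y := fun v hv =>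
    ((hXY ▸ Set.mem_univ v : v ∈ X ∪ Y)).resolve_left hv
  have hnb : ∀ v x, v ∉ X → G.Adj v x → x ∈ X := by
    intro v x hv hvx
    by_contra hx
    exact hY (hmem v hv) (hmem x hx) hvx.ne hvx
  by_cases hc : ∃ p ∈ X, ∃ q ∈ X, T.dist p q = 2
  · obtain ⟨p, hp, q, hq, hpq⟩ := hc
    obtain ⟨z, hzp, hzq⟩ := hT.exists_adj_adj_of_dist_eq_two hpq
    have hne : p ≠ q := by rintro rfl; simp at hpq
    have hXd : ∀ x ∈ X, ∀ y ∈ X, T.dist x y ≤ 2 := by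
      intro x hx y hy
      by_cases hxy : x = y
      · simp [hxy]
      · exact hd _ _ (hX hx hy hxy)
    -- The midpoint of one clique pair at tree distance 2 dominates the whole clique in `T`.
    have hXz : ∀ x ∈ X, x = z ∨ T.Adj x z := fun x hx => hT.eq_or_adj_of_dist_le_one
      (hT.dist_le_one_of_two_neighbors hzp hzq hne (hXd x hx p hp) (hXd x hx q hq))
    refine ⟨z, fun v hvz hv x y hvx hvy => ?_⟩
    have hvX : v ∉ X := fun h => (hXz v h).elim hvz fun h => hv (hTG h.symm)
    have hadj : ∀ x, G.Adj v x → T.Adj z x := fun x hvx =>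
      ((hXz x (hnb v x hvX hvx)).resolve_left (by rintro rfl; exact hv hvx.symm)).symm
    by_contra hxy
    rcases hT.eq_or_adj_of_dist_le_one (hT.dist_le_one_of_two_neighbors (hadj x hvx) (hadj y hvy)
      hxy (hd _ _ hvx) (hd _ _ hvy)) with h | h
    · exact hvz h
    · exact hv (hTG h.symm)
  · push Not at hc
    have hXT : ∀ x ∈ X, ∀ y ∈ X, x ≠ y → T.Adj x y := by
      intro x hx y hy hxy
      have h1 := hd _ _ (hX hx hy hxy)
      have h2 := hc x hx y hy
      exact (hT.eq_or_adj_of_dist_le_one (by omega)).resolve_left hxy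
    by_cases hne : X.Nonempty
    · obtain ⟨c, hcX⟩ := hne
      refine ⟨c, fun v hvc hv x y hvx hvy => ?_⟩
      have hvX : v ∉ X := fun h => hv (hX hcX h hvc.symm)
      by_contra hxy
      have hx := hXT c hcX x (hnb v x hvX hvx) (by rintro rfl; exact hv hvx.symm)
      have hy := hXT c hcX y (hnb v y hvX hvy) (by rintro rfl; exact hv hvy.symm)
      have hxy' := hXT x (hnb v x hvX hvx) y (hnb v y hvX hvy) hxy
      -- Otherwise `c`, `x`, `y` would form a triangle in `T`.
      exact hT.dist_ne_of_adj c hxy' (by rw [dist_eq_one_iff_adj.mpr hx, dist_eq_one_iff_adj.mpr hy])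
    · obtain ⟨c⟩ := hT.connected.nonempty
      refine ⟨c, fun v _ _ x y hvx _ => ?_⟩
      exact absurd ⟨x, hnb v x (fun h => hne ⟨v, h⟩) hvx⟩ hne

end SimpleGraph

/-! ### Matchings in bipartite graphs -/

/-- A regular bipartite multigraph, given by its matrix of multiplicities, has a perfect matching. -/
theorem exists_bijective_of_regular {α β : Type*} [Fintype α] [Fintype β] (w : α → β → ℕ) {u : ℕ}
    (hu : 0 < u) (hrow : ∀ a, ∑ b, w a b = u) (hcol : ∀ b, ∑ a, w a b = u) :
    ∃ g : α → β, Function.Bijective g ∧ ∀ a, w a (g a) ≠ 0 := by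
  classical
  have hcard : Fintype.card α = Fintype.card β := by
    have h1 : ∑ a, ∑ b, w a b = Fintype.card α * u := by simp [hrow]
    have h2 : ∑ b, ∑ a, w a b = Fintype.card β * u := by simp [hcol]
    rw [Finset.sum_comm] at h2
    exact Nat.eq_of_mul_eq_mul_right hu (h1.symm.trans h2)
  obtain ⟨g, hg, hgw⟩ := (Finset.all_card_le_biUnion_card_iff_exists_injective
    (fun a => Finset.univ.filter fun b => w a b ≠ 0)).mp (by
      intro s
      -- Hall's condition, by double counting: the rows in `s` have total weight |s|u, all of it in
      -- columns of `N`, which carry only |N|u.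
      refine Nat.le_of_mul_le_mul_right ?_ hu
      set N := s.biUnion fun a => Finset.univ.filter fun b => w a b ≠ 0 with hN
      calc s.card * u = ∑ a ∈ s, ∑ b, w a b := by simp [hrow]
        _ = ∑ a ∈ s, ∑ b ∈ N, w a b := by
          refine Finset.sum_congr rfl fun a ha => (Finset.sum_subset (Finset.subset_univ _) ?_).symm
          intro b _ hb
          by_contra h
          exact hb (Finset.mem_biUnion.mpr ⟨a, ha, by simpa using h⟩)
        _ = ∑ b ∈ N, ∑ a ∈ s, w a b := Finset.sum_comm
        _ ≤ ∑ b ∈ N, ∑ a, w a b :=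
          Finset.sum_le_sum fun b _ => Finset.sum_le_sum_of_subset (Finset.subset_univ s)
        _ = N.card * u := by simp [hcol])
  exact ⟨g, (Fintype.bijective_iff_injective_and_card g).mpr ⟨hg, hcard⟩,
    fun a => (Finset.mem_filter.mp (hgw a)).2⟩

/-- A bipartite graph which is `u`-regular on one side and of maximum degree at most `u` on the
other has a matching that covers the first side and all vertices of degree `u` of the other. -/
theorem exists_injective_covering {ι C : Type*} [Fintype ι] [Fintype C] (R : ι → C → Prop)
    [∀ i c, Decidable (R i c)] {u : ℕ} (hu : 0 < u)
    (hrow : ∀ i, (Finset.univ.filter fun c => R i c).card = u)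
    (hcol : ∀ c, (Finset.univ.filter fun i => R i c).card ≤ u) :
    ∃ g : ι → C, Function.Injective g ∧ (∀ i, R i (g i)) ∧
      ∀ c, (Finset.univ.filter fun i => R i c).card = u → ∃ i, g i = c := by
  classical
  -- The block matrix [R, 0; D, Rᵀ], with D the diagonal matrix of deficits u - deg c, is u-regular.
  -- A column `c` of degree `u` has deficit 0, so a perfect matching must cover it from `ι`.
  let w : ι ⊕ C → C ⊕ ι → ℕ := fun a b => match a, b with
    | .inl i, .inl c => if R i c then 1 else 0
    | .inl _, .inr _ => 0
    | .inr c, .inl c' => if c = c' then u - (Finset.univ.filter fun i => R i c).card else 0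
    | .inr c, .inr i => if R i c then 1 else 0
  obtain ⟨g, hg, hgw⟩ := exists_bijective_of_regular w hu
    (by
      rintro (i | c)
      · simpa [w, Fintype.sum_sum_type] using hrow i
      · have := hcol c
        simp [w, Fintype.sum_sum_type]
        omega)
    (by
      rintro (c | i)
      · have := hcol c
        simp [w, Fintype.sum_sum_type]
        omega
      · simpa [w, Fintype.sum_sum_type] using hrow i)
  have h1 : ∀ i, ∃ c, g (.inl i) = .inl c ∧ R i c := by
    intro i
    have := hgw (.inl i)
    rcases hgi : g (.inl i) with c | j
    · exact ⟨c, rfl, by simpa [w, hgi] using this⟩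
    · simp [w, hgi] at this
  choose f hf hR using h1
  refine ⟨f, fun i j hij => ?_, hR, fun c hc => ?_⟩
  · exact Sum.inl_injective (hg.1 (by rw [hf, hf, hij]))
  · obtain ⟨a, ha⟩ := hg.2 (.inl c)
    rcases a with i | c'
    · exact ⟨i, Sum.inl_injective ((hf i).symm.trans ha)⟩
    · have := hgw (.inr c')
      rw [ha] at this
      by_cases h : c' = c
      · subst h; simp [w, hc] at this
      · simp [w, h] at this
-- Edge colorings: counting bound, greedy extension, cyclic coloring
namespace SimpleGraph

/-- Edges of `G` with a common endpoint receive distinct colors. Values outside the edge set are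
irrelevant. -/
def IsProperEdgeColoring {V C : Type*} (G : SimpleGraph V) (col : Sym2 V → C) : Prop :=
  ∀ v x y, G.Adj v x → G.Adj v y → x ≠ y → col s(v, x) ≠ col s(v, y)

theorem lineGraph_colorable_of_isProperEdgeColoring {V : Type*} {G : SimpleGraph V} {k : ℕ}
    {col : Sym2 V → Fin k} (h : G.IsProperEdgeColoring col) : G.lineGraph.Colorable k := by
  refine ⟨Coloring.mk (fun e => col e.1) ?_⟩
  rintro ⟨e, he⟩ ⟨f, hf⟩ ⟨hne, v, hve, hvf⟩
  obtain ⟨x, rfl⟩ : ∃ x, e = s(v, x) := hve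
  obtain ⟨y, rfl⟩ : ∃ y, f = s(v, y) := hvf
  exact h v x y he hf (by rintro rfl; exact hne rfl)

theorem exists_isProperEdgeColoring_of_colorable {V : Type*} {G : SimpleGraph V} {k : ℕ}
    (hk : 0 < k) (h : G.lineGraph.Colorable k) :
    ∃ col : Sym2 V → Fin k, G.IsProperEdgeColoring col := by
  classical
  obtain ⟨c⟩ := h
  refine ⟨fun e => if he : e ∈ G.edgeSet then c ⟨e, he⟩ else ⟨0, hk⟩, fun v x y hx hy hxy => ?_⟩
  beta_reduce
  rw [dif_pos (show s(v, x) ∈ G.edgeSet from hx), dif_pos (show s(v, y) ∈ G.edgeSet from hy)]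
  refine c.valid ⟨fun h => hxy ?_, v, ?_, ?_⟩
  · exact Sym2.congr_right.mp (congrArg Subtype.val h)
  · simp
  · simp

/-- Each color class is a matching, which bounds the number of edges. -/
theorem IsProperEdgeColoring.ncard_edgeSet_le {V C : Type*} [Fintype V] [Fintype C]
    {G : SimpleGraph V} {col : Sym2 V → C} (h : G.IsProperEdgeColoring col) :
    G.edgeSet.ncard ≤ Fintype.card C * (Fintype.card V / 2) := by
  classical
  rw [Set.ncard_eq_toFinset_card']
  refine Finset.card_le_mul_card_image_of_maps_to (f := col) (t := Finset.univ)
    (fun _ _ => Finset.mem_univ _) _ (fun c _ => ?_) |>.trans_eq (by rw [Finset.card_univ, mul_comm])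
  set A := G.edgeSet.toFinset.filter fun e => col e = c with hA
  have hmem : ∀ e ∈ A, e ∈ G.edgeSet ∧ col e = c := fun e he => by simpa [hA] using he
  have hdisj : (A : Set (Sym2 V)).PairwiseDisjoint Sym2.toFinset := by
    intro e he f hf hne
    refine Finset.disjoint_left.mpr fun v hve hvf => ?_
    rw [Sym2.mem_toFinset] at hve hvf
    obtain ⟨x, rfl⟩ : ∃ x, e = s(v, x) := hve
    obtain ⟨y, rfl⟩ : ∃ y, f = s(v, y) := hvf
    obtain ⟨h1, h2⟩ := hmem _ he
    obtain ⟨h3, h4⟩ := hmem _ hf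
    exact h v x y h1 h3 (by rintro rfl; exact hne rfl) (h2.trans h4.symm)
  have h1 := Finset.card_biUnion hdisj
  rw [Finset.sum_congr rfl fun e he => Sym2.card_toFinset_of_not_isDiag e
    (G.not_isDiag_of_mem_edgeSet (hmem e he).1)] at h1
  have h2 := Finset.card_le_univ (A.biUnion Sym2.toFinset)
  rw [h1, Finset.sum_const, smul_eq_mul] at h2
  omega

/-- Greedy extension of an edge coloring in which certain colors are forbidden at each vertex. -/
theorem exists_isProperEdgeColoring_extension {V C : Type*} [Finite V] [Finite C]
    {G₀ G : SimpleGraph V} (hle : G₀ ≤ G) (bad : V → Set C)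
    (hcond : ∀ a b, G.Adj a b → ¬ G₀.Adj a b →
      (G.neighborSet a).ncard + (G.neighborSet b).ncard + (bad a).ncard + (bad b).ncard
        < Nat.card C + 2)
    (h₀ : ∃ col : Sym2 V → C, G₀.IsProperEdgeColoring col ∧
      ∀ v x, G₀.Adj v x → col s(v, x) ∉ bad v) :
    ∃ col : Sym2 V → C, G.IsProperEdgeColoring col ∧ ∀ v x, G.Adj v x → col s(v, x) ∉ bad v := by
  classical
  obtain ⟨K, hK₀, hK⟩ := Finite.exists_le_maximal (p := fun K : SimpleGraph V => K ≤ G ∧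
    ∃ col : Sym2 V → C, K.IsProperEdgeColoring col ∧ ∀ v x, K.Adj v x → col s(v, x) ∉ bad v)
    ⟨hle, h₀⟩
  obtain ⟨⟨hKG, col, hcol, hbad⟩, hmax⟩ := hK
  suffices h : G ≤ K by
    obtain rfl := le_antisymm hKG h
    exact ⟨col, hcol, hbad⟩
  intro a b hab
  by_contra hnot
  have hdeg : ∀ a b, G.Adj a b → ¬ K.Adj a b →
      (K.neighborSet a).ncard + 1 ≤ (G.neighborSet a).ncard := by
    intro a b hab hnot
    rw [← Set.ncard_insert_of_notMem (show b ∉ K.neighborSet a from hnot)]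
    exact Set.ncard_le_ncard (Set.insert_subset hab fun x hx => hKG hx)
  have hda := hdeg a b hab hnot
  have hdb := hdeg b a hab.symm fun h => hnot h.symm
  have hlt := hcond a b hab fun h => hnot (hK₀ h)
  -- The edge `ab` is still uncolored, so each end sees at most its degree in `G` minus one colors;
  -- this is the 2 in `hcond`.
  obtain ⟨c, hc⟩ : ∃ c, c ∉ (((fun x => col s(a, x)) '' K.neighborSet a ∪
      (fun x => col s(b, x)) '' K.neighborSet b) ∪ bad a) ∪ bad b := by
    by_contra! hall
    have h1 := Set.ncard_union_le ((((fun x => col s(a, x)) '' K.neighborSet a) ∪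
      (fun x => col s(b, x)) '' K.neighborSet b) ∪ bad a) (bad b)
    have h2 := Set.ncard_union_le (((fun x => col s(a, x)) '' K.neighborSet a) ∪
      (fun x => col s(b, x)) '' K.neighborSet b) (bad a)
    have h3 := Set.ncard_union_le ((fun x => col s(a, x)) '' K.neighborSet a)
      ((fun x => col s(b, x)) '' K.neighborSet b)
    have h4 := Set.ncard_image_le (f := fun x => col s(a, x)) (K.neighborSet a).toFinite
    have h5 := Set.ncard_image_le (f := fun x => col s(b, x)) (K.neighborSet b).toFinite
    rw [Set.eq_univ_of_forall hall, Set.ncard_univ] at h1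
    omega
  simp only [Set.mem_union, Set.mem_image, mem_neighborSet, not_or, not_exists, not_and] at hc
  obtain ⟨⟨⟨hca, hcb⟩, hba⟩, hbb⟩ := hc
  have hadd : ∀ v x, (K ⊔ edge a b).Adj v x →
      (K.Adj v x ∧ s(v, x) ≠ s(a, b)) ∨ (v = a ∧ x = b) ∨ (v = b ∧ x = a) := by
    intro v x h
    rcases h with h | h
    · refine .inl ⟨h, fun heq => hnot ?_⟩
      rw [← mem_edgeSet, ← heq]
      exact h
    · exact .inr (by rw [edge_adj] at h; exact h.1)
  refine hnot (hmax (y := K ⊔ edge a b) ⟨sup_le hKG ?_, fun e => if e = s(a, b) then c else col e,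
    ?_, ?_⟩ le_sup_left (Or.inr ?_))
  · intro v x h
    rw [edge_adj] at h
    rcases h.1 with ⟨rfl, rfl⟩ | ⟨rfl, rfl⟩
    exacts [hab, hab.symm]
  · intro v x y hx hy hxy
    beta_reduce
    rcases hadd v x hx with ⟨hxK, hx'⟩ | ⟨rfl, rfl⟩ | ⟨rfl, rfl⟩ <;>
    rcases hadd v y hy with ⟨hyK, hy'⟩ | ⟨h1, h2⟩ | ⟨h1, h2⟩
    · rw [if_neg hx', if_neg hy']
      exact hcol v x y hxK hyK hxy
    · subst h1 h2
      rw [if_neg hx', if_pos rfl]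
      exact hca x hxK
    · subst h1 h2
      rw [if_neg hx', if_pos Sym2.eq_swap]
      exact hcb x hxK
    · rw [if_pos rfl, if_neg hy']
      exact fun h => hca y hyK h.symm
    · exact absurd h2.symm hxy
    · exact absurd h1 hab.ne
    · rw [if_pos Sym2.eq_swap, if_neg hy']
      exact fun h => hcb y hyK h.symm
    · exact absurd h1 hab.ne'
    · exact absurd h2.symm hxy
  · intro v x hx
    rcases hadd v x hx with ⟨hx, hx'⟩ | ⟨rfl, rfl⟩ | ⟨rfl, rfl⟩
    · simpa [hx'] using hbad v x hx
    · simpa using hba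
    · simpa [Sym2.eq_swap] using hbb
  · simp [edge_adj, hab.ne]

/-- The edges inside a set of `s ≤ k` vertices can be colored with `k` colors. -/
theorem exists_isProperEdgeColoring_of_support {V : Type*} [Finite V] {G : SimpleGraph V}
    {S : Set V} (hS : ∀ v x, G.Adj v x → v ∈ S) {k : ℕ} (hne : S.Nonempty) (hk : S.ncard ≤ k) :
    ∃ col : Sym2 V → Fin k, G.IsProperEdgeColoring col := by
  classical
  have hpos : 0 < S.ncard := (Set.ncard_pos S.toFinite).mpr hne
  have : NeZero S.ncard := ⟨hpos.ne'⟩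
  have e : S ≃ Fin S.ncard := Finite.equivFin S
  let f : V → Fin S.ncard := fun v => if h : v ∈ S then e ⟨v, h⟩ else 0
  have hf : ∀ x ∈ S, ∀ y ∈ S, f x = f y → x = y := by
    intro x hx y hy h
    simp only [f, dif_pos hx, dif_pos hy] at h
    simpa using e.injective h
  -- The color of `xy` is the sum of the labels modulo |S|; cancellation makes it proper.
  refine ⟨fun z => Fin.castLE hk (Sym2.lift ⟨fun a b => f a + f b, fun a b => add_comm _ _⟩ z),
    fun v x y hx hy hxy h => hxy (hf x (hS x v hx.symm) y (hS y v hy.symm) ?_)⟩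
  simpa using Fin.castLE_injective hk h

end SimpleGraph
-- Cruse-type extension with reserved colors
namespace SimpleGraph

/-- `col` properly colors the edges of `G` inside `S`, and no edge at `v` has a color `c` which is
reserved for `v`, that is, with `ρ c = v`. -/
def IsReservedColoringOn {V C : Type*} (G : SimpleGraph V) (ρ : C → V) (S : Finset V)
    (col : Sym2 V → C) : Prop :=
  (∀ v ∈ S, ∀ x ∈ S, ∀ y ∈ S, G.Adj v x → G.Adj v y → x ≠ y → col s(v, x) ≠ col s(v, y)) ∧
    ∀ v ∈ S, ∀ x ∈ S, G.Adj v x → ρ (col s(v, x)) ≠ v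

/-- The color `c` is neither reserved for `v` nor used at `v` inside `S`. -/
def IsFreeColor {V C : Type*} (G : SimpleGraph V) (ρ : C → V) (S : Finset V)
    (col : Sym2 V → C) (v : V) (c : C) : Prop :=
  ρ c ≠ v ∧ ∀ x ∈ S, G.Adj v x → col s(v, x) ≠ c

-- A vertex has as many unreserved colors as neighbors. Its edges inside `S` use up one each,
-- leaving one free color for each of the |V| - |S| vertices outside, all of which are its
-- neighbors.
open Classical in
theorem IsReservedColoringOn.card_isFreeColor {V C : Type*} [Fintype V] [Fintype C]
    {G : SimpleGraph V} {ρ : C → V} {S : Finset V} {col : Sym2 V → C}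
    (h : G.IsReservedColoringOn ρ S col) {v : V} (hv : v ∈ S)
    (huniv : ∀ z ∉ S, G.Adj v z)
    (hdeg : (Finset.univ.filter fun x => G.Adj v x).card +
      (Finset.univ.filter fun c => ρ c = v).card = Fintype.card C)
    (hC : Fintype.card C + 1 = Fintype.card V) :
    (Finset.univ.filter fun c => G.IsFreeColor ρ S col v c).card + S.card = Fintype.card V := by
  have h1 : (Finset.univ.filter fun x => G.Adj v x) = (S.filter fun x => G.Adj v x) ∪ Sᶜ := by
    ext x
    by_cases hx : x ∈ S
    · simp [hx]
    · simp [hx, huniv x hx]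
  have hd1 : Disjoint (S.filter fun x => G.Adj v x) Sᶜ :=
    Finset.disjoint_left.mpr fun x hx hx' => by simp at hx hx'; exact hx' hx.1
  rw [h1, Finset.card_union_of_disjoint hd1, Finset.card_compl] at hdeg
  have himg : ((S.filter fun x => G.Adj v x).image fun x => col s(v, x)).card =
      (S.filter fun x => G.Adj v x).card := by
    refine Finset.card_image_of_injOn fun x hx y hy hxy => ?_
    simp only [Finset.coe_filter, Set.mem_ofPred_eq] at hx hy
    by_contra hne
    exact h.1 v hv x hx.1 y hy.1 hx.2 hy.2 hne hxy
  have h2 : (Finset.univ : Finset C) = ((Finset.univ.filter fun c => ρ c = v) ∪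
      (S.filter fun x => G.Adj v x).image fun x => col s(v, x)) ∪
      Finset.univ.filter fun c => G.IsFreeColor ρ S col v c := by
    ext c
    simp only [Finset.mem_univ, Finset.mem_union, Finset.mem_filter, Finset.mem_image, true_and,
      true_iff]
    by_cases h1 : ρ c = v
    · exact .inl (.inl h1)
    · by_cases h2 : ∃ x, (x ∈ S ∧ G.Adj v x) ∧ col s(v, x) = c
      · exact .inl (.inr h2)
      · exact .inr ⟨h1, fun x hx hvx hc => h2 ⟨x, ⟨hx, hvx⟩, hc⟩⟩
  have hd2 : Disjoint (Finset.univ.filter fun c => ρ c = v)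
      ((S.filter fun x => G.Adj v x).image fun x => col s(v, x)) := by
    refine Finset.disjoint_left.mpr fun c hc hc' => ?_
    simp only [Finset.mem_filter, Finset.mem_image, Finset.mem_univ, true_and] at hc hc'
    obtain ⟨x, ⟨hx, hvx⟩, rfl⟩ := hc'
    exact h.2 v hv x hx hvx hc
  have hd3 : Disjoint ((Finset.univ.filter fun c => ρ c = v) ∪
      (S.filter fun x => G.Adj v x).image fun x => col s(v, x))
      (Finset.univ.filter fun c => G.IsFreeColor ρ S col v c) := by
    refine Finset.disjoint_left.mpr fun c hc hc' => ?_
    simp only [Finset.mem_filter, Finset.mem_image, Finset.mem_union, Finset.mem_univ,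
      true_and] at hc hc'
    rcases hc with hc | ⟨x, ⟨hx, hvx⟩, hxc⟩
    · exact hc'.1 hc
    · exact hc'.2 x hx hvx hxc
  have h3 := congrArg Finset.card h2
  rw [Finset.card_union_of_disjoint hd3, Finset.card_union_of_disjoint hd2, himg,
    Finset.card_univ] at h3
  have := Finset.card_le_univ S
  omega

open Classical in
/-- Every vertex of `S` is free for `c`, covered by an edge of color `c`, or equal to `ρ c`. -/
theorem IsReservedColoringOn.odd_card_isFreeColor_add {V C : Type*} [Fintype V]
    {G : SimpleGraph V} {ρ : C → V} {S : Finset V} {col : Sym2 V → C}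
    (h : G.IsReservedColoringOn ρ S col) {c : C} (hc : ρ c ∈ S) :
    Odd ((S.filter fun v => G.IsFreeColor ρ S col v c).card + S.card) := by
  -- The edges of color `c` form a matching, so they cover an even number of vertices: the
  -- odd-degree vertices of `K`.
  let K : SimpleGraph V :=
    { Adj := fun v x => v ∈ S ∧ x ∈ S ∧ G.Adj v x ∧ col s(v, x) = c
      symm := ⟨fun v x h => ⟨h.2.1, h.1, h.2.2.1.symm, by rw [Sym2.eq_swap]; exact h.2.2.2⟩⟩
      loopless := ⟨fun v h => h.2.2.1.ne rfl⟩ }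
  have hodd : (Finset.univ.filter fun v => Odd (K.degree v)) =
      S.filter fun v => ∃ x ∈ S, G.Adj v x ∧ col s(v, x) = c := by
    ext v
    simp only [Finset.mem_filter, Finset.mem_univ, true_and]
    constructor
    · intro hv
      obtain ⟨x, hx⟩ := (K.degree_pos_iff_exists_adj v).mp hv.pos
      exact ⟨hx.1, x, hx.2⟩
    · rintro ⟨hv, x, hx, hvx, hcol⟩
      have : K.neighborFinset v = {x} := by
        ext y
        simp only [mem_neighborFinset, Finset.mem_singleton]
        constructor
        · intro hy
          by_contra hne
          exact h.1 v hv y hy.2.1 x hx hy.2.2.1 hvx hne (hy.2.2.2.trans hcol.symm)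
        · rintro rfl
          exact ⟨hv, hx, hvx, hcol⟩
      rw [← card_neighborFinset_eq_degree, this]
      simp
  have heven := K.even_card_odd_degree_vertices
  rw [hodd] at heven
  have hS : S = insert (ρ c) ((S.filter fun v => ∃ x ∈ S, G.Adj v x ∧ col s(v, x) = c) ∪
      S.filter fun v => G.IsFreeColor ρ S col v c) := by
    ext v
    simp only [Finset.mem_insert, Finset.mem_union, Finset.mem_filter]
    constructor
    · intro hv
      by_cases h1 : v = ρ c
      · exact .inl h1
      · by_cases h2 : ∃ x ∈ S, G.Adj v x ∧ col s(v, x) = c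
        · exact .inr (.inl ⟨hv, h2⟩)
        · exact .inr (.inr ⟨hv, Ne.symm h1, fun x hx hvx hcol => h2 ⟨x, hx, hvx, hcol⟩⟩)
    · rintro (rfl | h | h)
      exacts [hc, h.1, h.1]
  have hd : Disjoint (S.filter fun v => ∃ x ∈ S, G.Adj v x ∧ col s(v, x) = c)
      (S.filter fun v => G.IsFreeColor ρ S col v c) := by
    refine Finset.disjoint_left.mpr fun v hv hv' => ?_
    obtain ⟨-, x, hx, hvx, hcol⟩ := Finset.mem_filter.mp hv
    exact (Finset.mem_filter.mp hv').2.2 x hx hvx hcol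
  have hnot : ρ c ∉ (S.filter fun v => ∃ x ∈ S, G.Adj v x ∧ col s(v, x) = c) ∪
      S.filter fun v => G.IsFreeColor ρ S col v c := by
    simp only [Finset.mem_union, Finset.mem_filter, not_or]
    refine ⟨?_, fun h => h.2.1 rfl⟩
    rintro ⟨-, x, hx, hvx, hcol⟩
    exact h.2 _ hc x hx hvx (by rw [hcol])
  have h3 := congrArg Finset.card hS
  rw [Finset.card_insert_of_notMem hnot, Finset.card_union_of_disjoint hd] at h3
  rw [Nat.even_iff] at heven
  rw [Nat.odd_iff]
  omega

open Classical in
/-- One step of a Cruse-type embedding: a coloring in which every color is free at few vertices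
extends to one further vertex adjacent to all others. -/
theorem IsReservedColoringOn.exists_insert {V C : Type*} [Fintype V] [Fintype C]
    {G : SimpleGraph V} {ρ : C → V} {S : Finset V} {col : Sym2 V → C}
    (h : G.IsReservedColoringOn ρ S col) (hρ : ∀ c, ρ c ∈ S)
    (huniv : ∀ z ∉ S, ∀ x, x ≠ z → G.Adj x z)
    (hdeg : ∀ v, (Finset.univ.filter fun x => G.Adj v x).card +
      (Finset.univ.filter fun c => ρ c = v).card = Fintype.card C)
    (hC : Fintype.card C + 1 = Fintype.card V) (hodd : Odd (Fintype.card V))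
    (hfree : ∀ c, (S.filter fun v => G.IsFreeColor ρ S col v c).card + S.card ≤ Fintype.card V)
    {z : V} (hz : z ∉ S) :
    ∃ col' : Sym2 V → C, G.IsReservedColoringOn ρ (insert z S) col' ∧
      ∀ c, ((insert z S).filter fun v => G.IsFreeColor ρ (insert z S) col' v c).card +
        (insert z S).card ≤ Fintype.card V := by
  have hlt : S.card < Fintype.card V := Finset.card_lt_univ_of_notMem hz
  have hsub : ∀ c, (Finset.univ.filter fun v : S => G.IsFreeColor ρ S col v c).card =
      (S.filter fun v => G.IsFreeColor ρ S col v c).card := by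
    intro c
    rw [← Finset.card_map (Function.Embedding.subtype _)]
    congr 1
    ext v
    simp [and_comm]
  -- The edge from `v` to `z` gets the color matched to `v`. Colors free at exactly |V| - |S|
  -- vertices must be used, since otherwise they would violate the bound for `insert z S`.
  obtain ⟨g₀, hginj, hgfree, hgtight⟩ := exists_injective_covering
    (fun (v : S) c => G.IsFreeColor ρ S col v c) (u := Fintype.card V - S.card) (by omega)
    (fun v => by
      have := h.card_isFreeColor v.2 (fun w hw => huniv w hw v fun h => hw (h ▸ v.2)) (hdeg v) hC
      omega)
    (fun c => by
      have := hfree c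
      rw [hsub]
      omega)
  have hne : Nonempty C := ⟨col s(z, z)⟩
  let g : V → C := fun v => if hv : v ∈ S then g₀ ⟨v, hv⟩ else Classical.arbitrary C
  have hg : ∀ v (hv : v ∈ S), g v = g₀ ⟨v, hv⟩ := fun v hv => dif_pos hv
  have hgS : ∀ v ∈ S, G.IsFreeColor ρ S col v (g v) := fun v hv => by
    rw [hg v hv]; exact hgfree ⟨v, hv⟩
  have hgi : ∀ v ∈ S, ∀ w ∈ S, g v = g w → v = w := by
    intro v hv w hw hvw
    rw [hg v hv, hg w hw] at hvw
    exact congrArg Subtype.val (hginj hvw)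
  let col' : Sym2 V → C := Sym2.lift ⟨fun a b => if a = z then g b else if b = z then g a else
    col s(a, b), by
      intro a b
      by_cases ha : a = z <;> by_cases hb : b = z <;> simp [ha, hb, Sym2.eq_swap]⟩
  have hcz : ∀ x, col' s(z, x) = g x := fun x => by simp [col']
  have hcz' : ∀ x, col' s(x, z) = g x := fun x => by rw [Sym2.eq_swap, hcz]
  have hcS : ∀ v ∈ S, ∀ x ∈ S, col' s(v, x) = col s(v, x) := by
    intro v hv x hx
    have h1 : v ≠ z := fun h => hz (h ▸ hv)
    have h2 : x ≠ z := fun h => hz (h ▸ hx)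
    simp [col', h1, h2]
  have hinS : ∀ v, v ∈ insert z S → G.Adj z v → v ∈ S := fun v hv hzv =>
    (Finset.mem_insert.mp hv).resolve_left hzv.ne'
  refine ⟨col', ⟨?_, ?_⟩, fun c => ?_⟩
  · intro v hv x hx y hy hvx hvy hxy
    rcases Finset.mem_insert.mp hv with rfl | hvS
    · rw [hcz, hcz]
      exact fun heq => hxy (hgi x (hinS x hx hvx) y (hinS y hy hvy) heq)
    · rcases Finset.mem_insert.mp hx with rfl | hxS <;> rcases Finset.mem_insert.mp hy with rfl | hyS
      · exact absurd rfl hxy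
      · rw [hcz', hcS v hvS y hyS]
        exact fun heq => (hgS v hvS).2 y hyS hvy heq.symm
      · rw [hcz', hcS v hvS x hxS]
        exact (hgS v hvS).2 x hxS hvx
      · rw [hcS v hvS x hxS, hcS v hvS y hyS]
        exact h.1 v hvS x hxS y hyS hvx hvy hxy
  · intro v hv x hx hvx
    rcases Finset.mem_insert.mp hv with rfl | hvS
    · exact fun heq => hz (heq ▸ hρ _)
    · rcases Finset.mem_insert.mp hx with rfl | hxS
      · rw [hcz']
        exact (hgS v hvS).1
      · rw [hcS v hvS x hxS]
        exact h.2 v hvS x hxS hvx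
  · rw [Finset.card_insert_of_notMem hz]
    have hfS : ∀ v ∈ S, G.IsFreeColor ρ (insert z S) col' v c →
        G.IsFreeColor ρ S col v c ∧ g v ≠ c := by
      rintro v hv ⟨h1, h2⟩
      refine ⟨⟨h1, fun x hx hvx => ?_⟩, ?_⟩
      · rw [← hcS v hv x hx]
        exact h2 x (Finset.mem_insert_of_mem hx) hvx
      · rw [← hcz']
        exact h2 z (Finset.mem_insert_self _ _) (huniv z hz v fun h => hz (h ▸ hv))
    by_cases hcr : ∃ v ∈ S, g v = c
    · obtain ⟨v, hv, rfl⟩ := hcr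
      have hle : ((insert z S).filter fun w => G.IsFreeColor ρ (insert z S) col' w (g v)) ⊆
          (S.filter fun w => G.IsFreeColor ρ S col w (g v)).erase v := by
        intro w hw
        obtain ⟨hwS, hwf⟩ := Finset.mem_filter.mp hw
        rcases Finset.mem_insert.mp hwS with rfl | hwS
        · exact absurd (hcz v) (hwf.2 v (Finset.mem_insert_of_mem hv)
            (huniv w hz v fun h => hz (h ▸ hv)).symm)
        · obtain ⟨h1, h2⟩ := hfS w hwS hwf
          exact Finset.mem_erase.mpr ⟨fun h => h2 (by rw [h]), Finset.mem_filter.mpr ⟨hwS, h1⟩⟩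
      have hvm : v ∈ S.filter fun w => G.IsFreeColor ρ S col w (g v) :=
        Finset.mem_filter.mpr ⟨hv, hgS v hv⟩
      have h1 := Finset.card_le_card hle
      have h2 := Finset.card_erase_add_one hvm
      have h3 := hfree (g v)
      omega
    -- An unused color may gain `z` as a free vertex, so the sum grows by up to 2. It was not tight,
    -- and both it and |V| are odd, so there was a slack of at least 2.
    · have hle : ((insert z S).filter fun w => G.IsFreeColor ρ (insert z S) col' w c) ⊆
          insert z (S.filter fun w => G.IsFreeColor ρ S col w c) := by
        intro w hw
        obtain ⟨hwS, hwf⟩ := Finset.mem_filter.mp hw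
        rcases Finset.mem_insert.mp hwS with rfl | hwS
        · exact Finset.mem_insert_self _ _
        · exact Finset.mem_insert_of_mem (Finset.mem_filter.mpr ⟨hwS, (hfS w hwS hwf).1⟩)
      have h1 := Finset.card_le_card hle
      have h2 := Finset.card_insert_le z (S.filter fun w => G.IsFreeColor ρ S col w c)
      have h3 := hfree c
      have h4 := Nat.odd_iff.mp (h.odd_card_isFreeColor_add (hρ c))
      have h5 := Nat.odd_iff.mp hodd
      have h6 : (S.filter fun w => G.IsFreeColor ρ S col w c).card ≠
          Fintype.card V - S.card := by
        intro heq
        obtain ⟨v, hv⟩ := hgtight c ((hsub c).trans heq)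
        exact hcr ⟨v, v.2, (hg v v.2).trans hv⟩
      omega

end SimpleGraph
namespace SimpleGraph

open Classical in
theorem IsReservedColoringOn.exists_isProperEdgeColoring {V C : Type*} [Fintype V] [Fintype C]
    {G : SimpleGraph V} {ρ : C → V} {S : Finset V} {col : Sym2 V → C}
    (h : G.IsReservedColoringOn ρ S col) (hρ : ∀ c, ρ c ∈ S)
    (huniv : ∀ z ∉ S, ∀ x, x ≠ z → G.Adj x z)
    (hdeg : ∀ v, (Finset.univ.filter fun x => G.Adj v x).card +
      (Finset.univ.filter fun c => ρ c = v).card = Fintype.card C)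
    (hC : Fintype.card C + 1 = Fintype.card V) (hodd : Odd (Fintype.card V))
    (hfree : ∀ c, (S.filter fun v => G.IsFreeColor ρ S col v c).card + S.card ≤ Fintype.card V) :
    ∃ col : Sym2 V → C, G.IsProperEdgeColoring col := by
  induction hn : Fintype.card V - S.card generalizing S col with
  | zero =>
    have hS : S = Finset.univ := (Finset.card_eq_iff_eq_univ S).mp (by
      have := Finset.card_le_univ S
      omega)
    subst hS
    exact ⟨col, fun v x y => h.1 v (Finset.mem_univ v) x (Finset.mem_univ x) y (Finset.mem_univ y)⟩
  | succ n ih =>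
    obtain ⟨z, hz⟩ : ∃ z, z ∉ S := by
      by_contra! hall
      rw [Finset.eq_univ_of_forall hall, Finset.card_univ] at hn
      omega
    obtain ⟨col', h', hfree'⟩ := h.exists_insert hρ huniv hdeg hC hodd hfree hz
    refine ih h' (fun c => Finset.mem_insert_of_mem (hρ c))
      (fun w hw => huniv w fun h => hw (Finset.mem_insert_of_mem h)) hfree' ?_
    rw [Finset.card_insert_of_notMem hz]
    omega

/-! ### Near-complete graphs of odd order -/

open Classical in
/-- Removing `m > 0` edges, spanning at most `m + 1` vertices, from the complete graph on `2m + 1`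
vertices leaves a graph with an edge coloring in `2m` colors. -/
theorem exists_isProperEdgeColoring_compl {V : Type*} [Fintype V] {F : SimpleGraph V} {m : ℕ}
    (hm : 0 < m) (hV : Fintype.card V = 2 * m + 1) (hF : F.edgeFinset.card = m) {W : Finset V}
    (hW : ∀ a b, F.Adj a b → a ∈ W) (hWm : W.card ≤ m + 1) :
    ∃ col : Sym2 V → Fin (2 * m), Fᶜ.IsProperEdgeColoring col := by
  have hC : Fintype.card F.Dart = 2 * m := by rw [F.dart_card_eq_twice_card_edges, hF]
  have hdart : ∀ v, (Finset.univ.filter fun d : F.Dart => d.fst = v).card = F.degree v := by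
    intro v
    convert F.dart_fst_fiber_card_eq_degree v
  have hdeg : ∀ v, (Finset.univ.filter fun x => Fᶜ.Adj v x).card + F.degree v = 2 * m := by
    intro v
    have h1 : (Finset.univ.filter fun x => Fᶜ.Adj v x).card = Fᶜ.degree v := by
      rw [← card_neighborFinset_eq_degree]
      congr 1
      ext x
      simp
    have h2 := F.degree_lt_card_verts v
    rw [h1, degree_compl]
    omega
  -- the part of the complement inside `W`
  let K : SimpleGraph V :=
    { Adj := fun a b => a ∈ W ∧ b ∈ W ∧ Fᶜ.Adj a b
      symm := ⟨fun a b h => ⟨h.2.1, h.1, h.2.2.symm⟩⟩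
      loopless := ⟨fun a h => h.2.2.ne rfl⟩ }
  have hne : Nonempty F.Dart := Fintype.card_pos_iff.mp (by omega)
  -- The neighbors of `a` in `K`, those in `F`, and `a` itself are disjoint parts of `W`. Summing
  -- over two ends gives at most 2m, enough for the greedy coloring.
  have hbound : ∀ a ∈ W, (K.neighborSet a).ncard + {d : F.Dart | d.fst = a}.ncard + 1 ≤ m + 1 := by
    intro a ha
    have h1 : {d : F.Dart | d.fst = a}.ncard = F.degree a := by
      rw [← hdart, Set.ncard_eq_toFinset_card']
      congr 1
      ext d
      simp
    have h2 : F.degree a = (F.neighborSet a).ncard := by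
      rw [Set.ncard_eq_toFinset_card', Set.toFinset_card, card_neighborSet_eq_degree]
    rw [h1, h2, ← Set.ncard_union_eq, ← Set.ncard_insert_of_notMem (a := a)]
    · refine le_trans ?_ hWm
      rw [← Set.ncard_coe_finset]
      refine Set.ncard_le_ncard ?_
      rintro x (rfl | hx | hx)
      exacts [ha, hx.2.1, hW x a hx.symm]
    · rintro (h | h)
      exacts [h.2.2.ne rfl, h.ne rfl]
    · refine Set.disjoint_left.mpr fun x hx hx' => ?_
      exact (compl_adj _ _ _ |>.mp hx.2.2).2 hx'
  obtain ⟨col, hcol, hres⟩ := exists_isProperEdgeColoring_extension (G₀ := ⊥) (G := K)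
    (C := F.Dart) bot_le (fun v => {d | d.fst = v})
    (by
      intro a b hab _
      have h1 := hbound a hab.1
      have h2 := hbound b hab.2.1
      rw [Nat.card_eq_fintype_card]
      omega)
    ⟨fun _ => Classical.arbitrary _, fun v x y h => h.elim, fun v x h => h.elim⟩
  have hcolW : Fᶜ.IsReservedColoringOn (fun d : F.Dart => d.fst) W col :=
    ⟨fun v hv x hx y hy hvx hvy hxy => hcol v x y ⟨hv, hx, hvx⟩ ⟨hv, hy, hvy⟩ hxy,
      fun v hv x hx hvx => hres v x ⟨hv, hx, hvx⟩⟩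
  obtain ⟨col', hcol'⟩ := hcolW.exists_isProperEdgeColoring (fun d => hW _ _ d.adj)
    (fun z hz x hxz => by
      rw [compl_adj]
      exact ⟨hxz, fun h => hz (hW z x h.symm)⟩)
    (fun v => by
      rw [hdart, hC]
      convert hdeg v) (by omega) (by rw [hV]; exact odd_two_mul_add_one m)
    -- The reserved vertex of `d` lies in `W` and is not free, so the sum is at most 2|W| - 1 ≤ 2m +
    -- 1. This is where |W| ≤ m + 1 is needed.
    (fun d => by
      have h1 : (W.filter fun v => Fᶜ.IsFreeColor (fun d : F.Dart => d.fst) W col v d) ⊆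
          W.erase d.fst := by
        intro v hv
        obtain ⟨hvW, hvf⟩ := Finset.mem_filter.mp hv
        exact Finset.mem_erase.mpr ⟨Ne.symm hvf.1, hvW⟩
      have h2 := Finset.card_le_card h1
      have h3 := Finset.card_erase_add_one (hW _ _ d.adj)
      omega)
  have e : F.Dart ≃ Fin (2 * m) := Fintype.equivFinOfCardEq hC
  exact ⟨e ∘ col', fun v x y hx hy hxy h => hcol' v x y hx hy hxy (e.injective h)⟩

open Classical in
/-- A graph whose edges all meet a clique has subgraphs with `j` edges on at most `j + 1` vertices. -/
theorem exists_le_card_edgeFinset_eq {V : Type*} [Fintype V] {K : SimpleGraph V} {Y : Set V}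
    (hY : K.IsClique Y) (hK : ∀ a b, K.Adj a b → a ∈ Y ∨ b ∈ Y) {j : ℕ}
    (hj : j ≤ K.edgeFinset.card) :
    ∃ F ≤ K, F.edgeFinset.card = j ∧
      ∃ W : Finset V, W.card ≤ j + 1 ∧ ∀ a b, F.Adj a b → a ∈ W := by
  induction j with
  | zero => exact ⟨⊥, bot_le, by simp, ∅, by simp, fun a b h => h.elim⟩
  | succ j ih =>
    obtain ⟨F, hFK, hF, W, hW, hFW⟩ := ih (by omega)
    obtain ⟨e, heK, heF⟩ := Finset.exists_mem_notMem_of_card_lt_card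
      (s := F.edgeFinset) (t := K.edgeFinset) (by omega)
    have key : ∀ (U : Finset V) (a b : V), K.Adj a b → ¬ F.Adj a b → U.card ≤ j + 2 →
        (∀ c d, F.Adj c d → c ∈ U) → a ∈ U → b ∈ U → ∃ F ≤ K, F.edgeFinset.card = j + 1 ∧
          ∃ W : Finset V, W.card ≤ j + 1 + 1 ∧ ∀ a b, F.Adj a b → a ∈ W := by
      intro U a b hab hnot hU hFU ha hb
      refine ⟨F ⊔ edge a b, sup_le hFK ?_, ?_, U, hU, ?_⟩
      · intro v x h
        rw [edge_adj] at h
        rcases h.1 with ⟨rfl, rfl⟩ | ⟨rfl, rfl⟩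
        exacts [hab, hab.symm]
      · rw [← hF, ← card_edgeFinset_sup_edge F hnot hab.ne]
        congr!
      · rintro v x (h | h)
        · exact hFU v x h
        · rw [edge_adj] at h
          rcases h.1 with ⟨rfl, rfl⟩ | ⟨rfl, rfl⟩
          exacts [ha, hb]
    obtain ⟨y, b, hyY, hyb, hynF⟩ : ∃ y b, y ∈ Y ∧ K.Adj y b ∧ ¬ F.Adj y b := by
      induction e with
      | _ a b =>
        rw [mem_edgeFinset, mem_edgeSet] at heK heF
        rcases hK a b heK with h | h
        · exact ⟨a, b, h, heK, heF⟩
        · exact ⟨b, a, h, heK.symm, fun h => heF h.symm⟩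
    -- The first edge brings two vertices; every later one must bring at most one.
    rcases Nat.eq_zero_or_pos j with rfl | hjpos
    · refine key {y, b} y b hyb hynF Finset.card_le_two (fun c d hcd => ?_) (by simp) (by simp)
      have : s(c, d) ∈ F.edgeFinset := by rwa [mem_edgeFinset]
      simp [Finset.card_eq_zero.mp hF] at this
    by_cases hyW : y ∈ W
    · exact key (insert b W) y b hyb hynF ((Finset.card_insert_le _ _).trans (by omega))
        (fun c d h => Finset.mem_insert_of_mem (hFW c d h)) (Finset.mem_insert_of_mem hyW) (Finset.mem_insert_self _ _)
    -- If `y` is new, the edge `yb` might bring two new vertices. It is replaced by an edge of the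
    -- clique from `y` to a vertex of `Y` already in `W`.
    · obtain ⟨f, hf⟩ := Finset.card_pos.mp (hF ▸ hjpos)
      obtain ⟨y', hy', hy'W⟩ : ∃ y' ∈ Y, y' ∈ W := by
        induction f with
        | _ a b =>
          rw [mem_edgeFinset, mem_edgeSet] at hf
          rcases hK a b (hFK hf) with h | h
          · exact ⟨a, h, hFW a b hf⟩
          · exact ⟨b, h, hFW b a hf.symm⟩
      have hne : y ≠ y' := by rintro rfl; exact hyW hy'W
      exact key (insert y W) y y' (hY hyY hy' hne) (fun h => hyW (hFW y y' h))
        ((Finset.card_insert_le _ _).trans (by omega))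
        (fun c d h => Finset.mem_insert_of_mem (hFW c d h))
        (Finset.mem_insert_self _ _) (Finset.mem_insert_of_mem hy'W)

open Classical in
/-- A split graph on `2m + 1` vertices with at most `2m²` edges has an edge coloring in `2m`
colors. -/
theorem IsSplitGraph.exists_isProperEdgeColoring {V : Type*} [Fintype V] {G : SimpleGraph V}
    (hG : G.IsSplitGraph) {m : ℕ} (hm : 0 < m) (hV : Fintype.card V = 2 * m + 1)
    (hE : G.edgeFinset.card ≤ 2 * m * m) :
    ∃ col : Sym2 V → Fin (2 * m), G.IsProperEdgeColoring col := by
  obtain ⟨X, Y, hXY, -, hX, hY⟩ := hG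
  -- Of the m(2m + 1) pairs at most 2m² are edges, so at least m are non-edges.
  have hsum : G.edgeFinset.card + Gᶜ.edgeFinset.card = m * (2 * m + 1) := by
    have h1 := G.sum_degrees_eq_twice_card_edges
    have h2 := Gᶜ.sum_degrees_eq_twice_card_edges
    have h3 : ∀ v, G.degree v + Gᶜ.degree v = 2 * m := fun v => by
      have := G.degree_lt_card_verts v
      rw [degree_compl]
      omega
    have h4 : ∑ v, G.degree v + ∑ v, Gᶜ.degree v = (2 * m + 1) * (2 * m) := by
      rw [← Finset.sum_add_distrib, Finset.sum_congr rfl fun v _ => h3 v]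
      simp [hV]
    linarith
  have hle : m ≤ Gᶜ.edgeFinset.card := by linarith
  obtain ⟨F, hFG, hF, W, hW, hFW⟩ := exists_le_card_edgeFinset_eq (K := Gᶜ) (Y := Y) (j := m)
    (fun a ha b hb hab => ⟨hab, hY ha hb hab⟩)
    (fun a b hab => by
      by_contra! h
      have hmem : ∀ v, v ∉ Y → v ∈ X := fun v hv =>
        ((hXY ▸ Set.mem_univ v : v ∈ X ∪ Y)).resolve_right hv
      exact hab.2 (hX (hmem a h.1) (hmem b h.2) hab.1))
    (by convert hle)
  obtain ⟨col, hcol⟩ := exists_isProperEdgeColoring_compl hm hV hF hFW hW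
  exact ⟨col, fun v x y hx hy => hcol v x y (le_compl_comm.mp hFG hx) (le_compl_comm.mp hFG hy)⟩

end SimpleGraph
-- Reduction to the closed neighborhood of the center
namespace SimpleGraph

theorem IsSplitGraph.induce {V : Type*} {G : SimpleGraph V} (hG : G.IsSplitGraph) (S : Set V) :
    (G.induce S).IsSplitGraph := by
  obtain ⟨X, Y, hXY, hdisj, hX, hY⟩ := hG
  refine ⟨Subtype.val ⁻¹' X, Subtype.val ⁻¹' Y, ?_, hdisj.preimage _, ?_, ?_⟩
  · rw [← Set.preimage_union, hXY, Set.preimage_univ]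
  · exact fun a ha b hb hab => hX ha hb (Subtype.coe_ne_coe.mpr hab)
  · exact fun a ha b hb hab => hY ha hb (Subtype.coe_ne_coe.mpr hab)

theorem exists_isTreeSpanner_of_stretchIndex_le {V : Type*} {G : SimpleGraph V} {t : ℕ}
    (h : G.stretchIndex ≤ t) : ∃ T, G.IsTreeSpanner T t := by
  have hlt : G.stretchIndex < ((t + 1 : ℕ) : ℕ∞) :=
    h.trans_lt (by exact_mod_cast Nat.lt_succ_self t)
  simp only [stretchIndex, iInf_lt_iff] at hlt
  obtain ⟨s, ⟨T, hTG, hT, hd⟩, hs⟩ := hlt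
  have hs : s < t + 1 := by exact_mod_cast hs
  exact ⟨T, hTG, hT, fun u v huv => (hd u v huv).trans (by omega)⟩

theorem ncard_neighborSet_eq_degree {V : Type*} [Fintype V] (G : SimpleGraph V)
    [DecidableRel G.Adj] (v : V) : (G.neighborSet v).ncard = G.degree v := by
  rw [Set.ncard_eq_toFinset_card', Set.toFinset_card, card_neighborSet_eq_degree]

theorem ncard_insert_neighborSet {V : Type*} [Fintype V] (G : SimpleGraph V)
    [DecidableRel G.Adj] (v : V) : (insert v (G.neighborSet v)).ncard = G.degree v + 1 := by
  rw [Set.ncard_insert_of_notMem (by simp), ncard_neighborSet_eq_degree]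

/-- The graph consisting of the edges of `G` inside `S`, on the same vertex set. -/
def restrictTo {V : Type*} (G : SimpleGraph V) (S : Set V) : SimpleGraph V where
  Adj a b := a ∈ S ∧ b ∈ S ∧ G.Adj a b
  symm := ⟨fun _ _ h => ⟨h.2.1, h.1, h.2.2.symm⟩⟩
  loopless := ⟨fun _ h => h.2.2.ne rfl⟩

/-- If all vertices outside `S` are pendant or isolated, an edge coloring of the part inside `S`
with at least `Δ(G)` colors extends to `G`. -/
theorem exists_isProperEdgeColoring_of_restrictTo {V : Type*} [Fintype V] {G : SimpleGraph V}
    [DecidableRel G.Adj] {S : Set V}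
    (hS : ∀ v ∉ S, ∀ x y, G.Adj v x → G.Adj v y → x = y) {k : ℕ} (hk : G.maxDegree ≤ k)
    (h : ∃ col : Sym2 V → Fin k, (G.restrictTo S).IsProperEdgeColoring col) :
    ∃ col : Sym2 V → Fin k, G.IsProperEdgeColoring col := by
  have hdeg : ∀ v, (G.neighborSet v).ncard ≤ k := fun v => by
    rw [ncard_neighborSet_eq_degree]
    exact (G.degree_le_maxDegree v).trans hk
  have hpend : ∀ v ∉ S, (G.neighborSet v).ncard ≤ 1 := fun v hv =>
    (Set.ncard_le_one_iff (Set.toFinite _)).mpr fun {x y} hx hy => hS v hv x y hx hy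
  obtain ⟨col, hcol, -⟩ := exists_isProperEdgeColoring_extension (G₀ := G.restrictTo S) (G := G)
    (C := Fin k) (fun a b hab => hab.2.2) (fun _ => ∅)
    -- An edge not inside `S` has an end of degree at most 1, the other of degree at most `k`, so
    -- the sum is below k + 2.
    (by
      intro a b hab hnot
      have ha := hdeg a
      have hb := hdeg b
      simp only [Set.ncard_empty, Nat.card_fin]
      by_cases haS : a ∈ S
      · have := hpend b fun hbS => hnot ⟨haS, hbS, hab⟩
        omega
      · have := hpend a haS
        omega)
    (h.imp fun col hcol => ⟨hcol, by simp⟩)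
  exact ⟨col, hcol⟩

theorem exists_isProperEdgeColoring_restrictTo_of_induce {V C : Type*} {G : SimpleGraph V}
    {S : Set V} (hS : S.Nonempty)
    (h : ∃ col : Sym2 S → C, (G.induce S).IsProperEdgeColoring col) :
    ∃ col : Sym2 V → C, (G.restrictTo S).IsProperEdgeColoring col := by
  classical
  obtain ⟨col, hcol⟩ := h
  obtain ⟨c, hc⟩ := hS
  let f : V → S := fun v => if hv : v ∈ S then ⟨v, hv⟩ else ⟨c, hc⟩
  refine ⟨fun e => col (e.map f), ?_⟩
  rintro v x y ⟨hv, hx, hvx⟩ ⟨-, hy, hvy⟩ hxy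
  have hf : ∀ w (hw : w ∈ S), f w = ⟨w, hw⟩ := fun w hw => dif_pos hw
  simp only [Sym2.map_mk, hf v hv, hf x hx, hf y hy]
  exact hcol _ _ _ hvx hvy fun h => hxy (congrArg Subtype.val h)

theorem lineGraph_colorable_of_maxDegree_eq_zero {V : Type*} [Fintype V] {G : SimpleGraph V}
    [DecidableRel G.Adj] (h : G.maxDegree = 0) (k : ℕ) : G.lineGraph.Colorable k := by
  have : IsEmpty G.edgeSet := by
    refine ⟨?_⟩
    rintro ⟨e, he⟩
    induction e with
    | _ a b =>
      have h1 := (G.degree_pos_iff_exists_adj a).mpr ⟨b, he⟩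
      have h2 := G.degree_le_maxDegree a
      omega
  exact .of_isEmpty _

theorem not_isOverfull_of_colorable {V : Type*} [Fintype V] {G : SimpleGraph V}
    [DecidableRel G.Adj] (h : G.lineGraph.Colorable G.maxDegree) : ¬ G.IsOverfull := by
  rw [IsOverfull, not_lt]
  rcases Nat.eq_zero_or_pos G.maxDegree with h0 | hpos
  · rw [h0] at h ⊢
    obtain ⟨c⟩ := h
    have : G.edgeSet = ∅ := Set.eq_empty_of_forall_notMem fun e he => (c ⟨e, he⟩).elim0
    simp [this]
  · obtain ⟨col, hcol⟩ := exists_isProperEdgeColoring_of_colorable hpos h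
    simpa using hcol.ncard_edgeSet_le

/-- The non-overfull case with even maximum degree attained at the center. -/
theorem IsSplitGraph.exists_isProperEdgeColoring_induce {V : Type*} [Fintype V]
    {G : SimpleGraph V} (hG : G.IsSplitGraph) [DecidableRel G.Adj] (hpos : 0 < G.maxDegree)
    (heven : Even G.maxDegree) {c : V} (hc : G.degree c = G.maxDegree)
    (hno : ¬ G.IsNeighborhoodOverfull) :
    ∃ col : Sym2 (insert c (G.neighborSet c) : Set V) → Fin G.maxDegree,
      (G.induce (insert c (G.neighborSet c))).IsProperEdgeColoring col := by
  classical
  obtain ⟨m, hm⟩ := heven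
  have hm : G.maxDegree = 2 * m := by omega
  have hmax : (G.induce (insert c (G.neighborSet c))).maxDegree = G.maxDegree := by
    refine le_antisymm (Copy.maxDegree_mono (Embedding.induce _).toCopy) ?_
    have hdeg : (G.induce (insert c (G.neighborSet c))).degree ⟨c, Set.mem_insert _ _⟩ =
        G.degree c := by
      convert degree_induce_of_neighborSet_subset (v := ⟨c, Set.mem_insert c (G.neighborSet c)⟩)
        (Set.subset_insert c (G.neighborSet c))
    rw [← hc, ← hdeg]
    exact degree_le_maxDegree _ _
  have hcard : Fintype.card (insert c (G.neighborSet c) : Set V) = 2 * m + 1 := by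
    rw [← Nat.card_eq_fintype_card, Nat.card_coe_set_eq, ncard_insert_neighborSet, hc, hm]
  have hE : ¬ (G.induce (insert c (G.neighborSet c))).IsOverfull := by
    intro hover
    refine hno ⟨c, ?_, ?_, ?_⟩
    · convert hmax
    · rw [hc, ← hmax]
    · convert hover
  rw [IsOverfull, not_lt, hmax, hcard, hm, show (2 * m + 1) / 2 = m by omega] at hE
  rw [hm]
  refine (hG.induce _).exists_isProperEdgeColoring (by omega) hcard ?_
  rwa [← Set.ncard_coe_finset, coe_edgeFinset]

end SimpleGraph

theorem mainTheorem1 {V : Type*} [Fintype V] (G : SimpleGraph V) [DecidableRel G.Adj]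
    (hsplit : G.IsSplitGraph) (hσ : G.stretchIndex = 2) (heven : Even G.maxDegree) :
    G.IsClassTwo ↔ G.IsNeighborhoodOverfull := by
  classical
  obtain ⟨T, hT⟩ := SimpleGraph.exists_isTreeSpanner_of_stretchIndex_le (t := 2) hσ.le
  obtain ⟨c, hc⟩ := hsplit.exists_center hT
  have hS : ∀ v ∉ insert c (G.neighborSet c), ∀ x y, G.Adj v x → G.Adj v y → x = y :=
    fun v hv => hc v (fun h => hv (.inl h)) fun h => hv (.inr h)
  have hne : (insert c (G.neighborSet c)).Nonempty := Set.insert_nonempty _ _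
  have hlarge : ∀ k, G.maxDegree ≤ k → G.degree c < k → G.lineGraph.Colorable k := by
    intro k hk hck
    obtain ⟨col, hcol⟩ := SimpleGraph.exists_isProperEdgeColoring_of_restrictTo hS hk
      (SimpleGraph.exists_isProperEdgeColoring_of_support
        (G := G.restrictTo _) (fun v x h => h.1) hne (by
        rw [G.ncard_insert_neighborSet]
        omega))
    exact SimpleGraph.lineGraph_colorable_of_isProperEdgeColoring hcol
  have hΔ := G.degree_le_maxDegree c
  rw [SimpleGraph.IsClassTwo, SimpleGraph.chromaticIndex, Nat.cast_add, Nat.cast_one,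
    SimpleGraph.chromaticNumber_eq_iff_colorable_not_colorable]
  constructor
  · rintro ⟨-, hnot⟩
    by_contra hno
    refine hnot ?_
    -- Edge colorings here are total functions on `Sym2 V`, so zero colors need separate treatment.
    rcases Nat.eq_zero_or_pos G.maxDegree with h0 | hpos
    · exact SimpleGraph.lineGraph_colorable_of_maxDegree_eq_zero h0 _
    rcases hΔ.lt_or_eq with hlt | heq
    · exact hlarge _ le_rfl hlt
    · obtain ⟨col, hcol⟩ := SimpleGraph.exists_isProperEdgeColoring_of_restrictTo hS le_rfl
        (SimpleGraph.exists_isProperEdgeColoring_restrictTo_of_induce hne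
          (hsplit.exists_isProperEdgeColoring_induce hpos heven heq hno))
      exact SimpleGraph.lineGraph_colorable_of_isProperEdgeColoring hcol
  · rintro ⟨v, hmax, -, hover⟩
    refine ⟨hlarge _ (by omega) (by omega), fun hcol => ?_⟩
    -- A coloring of `G` with Δ(G) = Δ(H) colors restricts to the overfull subgraph H.
    refine SimpleGraph.not_isOverfull_of_colorable ?_ hover
    rw [hmax]
    exact hcol.of_hom (SimpleGraph.Embedding.induce _).toCopy.toLineGraphEmbedding.toHom
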